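/- Let $(X,\Sigma,\mu)$ be a probability space and let $T:X\to X$ be an invertible measure preserving transformation (with measurable inverse); write $(T^k g)(x)=g(T^k x)$ for $k\in\mathbb Z$. Let $1<\alpha\le 2$, and let $M_\alpha$ be the set of all two-sided sequences $\mathbf a=(a_k)_{k\in\mathbb Z}$ of complex numbers with $$\sum_{k=-n}^{n}|a_k| = O\!\left(\frac{n^{\alpha-1}}{\log^{\alpha} n}\right)\qquad (n\to\infty).$$ Let $F=(f_i)_{i\in\mathbb Z}$ be a family of real-valued functions in $L_2(X,\mu)$ which is - $T$-admissible: $T f_i\le f_{i+1}$ and $T^{-1}f_{-i}\le f_{-(i+1)}$ a.e. for every $i\ge 0$; - strongly bounded: $\sup_{n\in\mathbb Z}\|f_n\|_2<\infty$; - symmetric: $T^{2i}f_{-i}=f_i$ a.e. for every $i\in\mathbb Z$. Then for every $\mathbf a\in M_\alpha$ the limit $$\lim_{n\to\infty}\ \sum_{\substack{i=-n\\ i\neq 0}}^{n}\frac{a_i f_i(x)}{i}$$ exists (as a finite complex number) for $\mu$-almost every $x\in X$. -/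

import Mathlib

open MeasureTheory Filter Topology

/-- The class `M_α` of two-sided complex sequences `a` with
`∑_{k=-n}^{n} |a_k| = O(n^{α-1} / log^α n)` as `n → ∞`. -/
def classM (α : ℝ) : Set (ℤ → ℂ) :=
  {a | (fun n : ℕ => ∑ k ∈ Finset.Icc (-(n : ℤ)) (n : ℤ), ‖a k‖)
      =O[atTop] fun n : ℕ => (n : ℝ) ^ (α - 1) / Real.log (n : ℝ) ^ α}

/-- The action `(T^k g)(x) = g(T^k x)`, `k ∈ ℤ`, of an invertible transformation `T` on functions. -/
def koopman {X : Type*} [MeasurableSpace X] (T : X ≃ᵐ X) (k : ℤ) (g : X → ℝ) : X → ℝ :=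
  fun x => g ((T.toEquiv ^ k : Equiv.Perm X) x)

/-- A `T`-admissible process on `ℤ` in `L_p`: a family `(f_i)` of real functions in `L_p(μ)` with
`T f_i ≤ f_{i+1}` and `T⁻¹ f_{-i} ≤ f_{-(i+1)}` almost everywhere for all `i ≥ 0`. -/
structure IsAdmissibleProcess {X : Type*} [MeasurableSpace X] (T : X ≃ᵐ X) (μ : Measure X)
    (p : ENNReal) (f : ℤ → X → ℝ) : Prop where
  memLp : ∀ i : ℤ, MemLp (f i) p μ
  le_succ : ∀ i : ℤ, 0 ≤ i → koopman T 1 (f i) ≤ᵐ[μ] f (i + 1)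
  le_neg_succ : ∀ i : ℤ, 0 ≤ i → koopman T (-1) (f (-i)) ≤ᵐ[μ] f (-(i + 1))

/-- Strong boundedness: `sup_{n ∈ ℤ} ‖f_n‖_p < ∞`. -/
def IsStronglyBounded {X : Type*} [MeasurableSpace X] (μ : Measure X)
    (p : ENNReal) (f : ℤ → X → ℝ) : Prop :=
  (⨆ n : ℤ, eLpNorm (f n) p μ) < ⊤

/-- Symmetry: `T^{2i} f_{-i} = f_i` almost everywhere, for all `i ∈ ℤ`. -/
def IsSymmetricProcess {X : Type*} [MeasurableSpace X] (T : X ≃ᵐ X) (μ : Measure X)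
    (f : ℤ → X → ℝ) : Prop :=
  ∀ i : ℤ, koopman T (2 * i) (f (-i)) =ᵐ[μ] f i

/-- The modulated partial sum `∑'_{i=-n}^{n} a_i f_i(x) / i`, the term `i = 0` being omitted. -/
noncomputable def modulatedHilbertSum {X : Type*} (a : ℤ → ℂ) (f : ℤ → X → ℝ) (n : ℕ) (x : X) : ℂ :=
  ∑ i ∈ (Finset.Icc (-(n : ℤ)) (n : ℤ)).erase 0, a i * (f i x : ℂ) / (i : ℂ)

/-!
The growth condition defining `classM α` already makes the modulated series absolutely convergent.
Indeed a dyadic block of `∑ ‖a k‖ / |k|` satisfies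
`∑_{2^j ≤ |k| < 2^(j+1)} ‖a k‖ / |k| ≤ 2^(-j) ∑_{|k| ≤ 2^(j+1)} ‖a k‖ = O((j + 1)^(-α))`,
because `α - 1 ≤ 1`, and this is summable over `j` because `1 < α`
(`summable_div_of_sum_range_isBigO`, `summable_norm_div_of_mem_classM`).
A strongly bounded family in `L²` of a probability space is bounded in `L¹`, so
`∑ ‖a i‖ |f i| / |i|` has finite integral, hence is finite almost everywhere
(`ae_summable_mul_of_eLpNorm_one_le`), and the symmetric partial sums converge.
-/

open MeasureTheory Filter Topology

/-- Dyadic condensation: a nonnegative sequence whose partial sums are `O(n^(α-1) / log^α n)` with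
`1 < α ≤ 2` is summable against the weights `1 / k`. -/
theorem summable_div_of_sum_range_isBigO {α : ℝ} (hα₁ : 1 < α) (hα₂ : α ≤ 2) {b : ℕ → ℝ}
    (hb : ∀ k, 0 ≤ b k)
    (h : (fun n : ℕ => ∑ k ∈ Finset.range (n + 1), b k)
      =O[atTop] fun n : ℕ => (n : ℝ) ^ (α - 1) / Real.log (n : ℝ) ^ α) :
    Summable fun k : ℕ => b k / k := by
  set B : ℕ → ℝ := fun j => ∑ k ∈ Finset.Ico (2 ^ j) (2 ^ (j + 1)), b k / k with hB
  have hB0 : ∀ j, 0 ≤ B j := fun j =>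
    Finset.sum_nonneg fun k _ => div_nonneg (hb k) (Nat.cast_nonneg k)
  have hBsum : Summable B := by
    obtain ⟨C, hC⟩ := h.bound
    have htend : Tendsto (fun j : ℕ => 2 ^ (j + 1)) atTop (atTop : Filter ℕ) :=
      (tendsto_pow_atTop_atTop_of_one_lt one_lt_two).comp (tendsto_add_atTop_nat 1)
    have hC' := htend.eventually hC
    have hs : Summable fun j : ℕ => 1 / ((j + 1 : ℕ) : ℝ) ^ α :=
      (summable_nat_add_iff 1).2 (Real.summable_one_div_nat_rpow.2 hα₁)
    refine summable_of_isBigO_nat hs (.of_bound (|C| * 2 / Real.log 2 ^ α) ?_)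
    filter_upwards [hC'] with j hj
    have hl : 0 < Real.log 2 := Real.log_pos one_lt_two
    have hj1 : (0 : ℝ) < ((j + 1 : ℕ) : ℝ) := by positivity
    have hS0 : 0 ≤ ∑ k ∈ Finset.range (2 ^ (j + 1) + 1), b k := Finset.sum_nonneg fun k _ => hb k
    have hblock : B j ≤ (∑ k ∈ Finset.range (2 ^ (j + 1) + 1), b k) / 2 ^ j := by
      rw [Finset.sum_div]
      calc B j ≤ ∑ k ∈ Finset.Ico (2 ^ j) (2 ^ (j + 1)), b k / 2 ^ j := by
            refine Finset.sum_le_sum fun k hk => ?_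
            have : (2 : ℝ) ^ j ≤ k := by exact_mod_cast (Finset.mem_Ico.1 hk).1
            exact div_le_div_of_nonneg_left (hb k) (by positivity) this
        _ ≤ _ := by
            refine Finset.sum_le_sum_of_subset_of_nonneg (fun k hk => ?_) fun k _ _ =>
              div_nonneg (hb k) (by positivity)
            have := (Finset.mem_Ico.1 hk).2
            exact Finset.mem_range.2 (by omega)
    have hpow : ((2 ^ (j + 1) : ℕ) : ℝ) ^ (α - 1) ≤ 2 ^ (j + 1) := by
      have h1 : (1 : ℝ) ≤ ((2 ^ (j + 1) : ℕ) : ℝ) := by exact_mod_cast Nat.one_le_two_pow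
      calc ((2 ^ (j + 1) : ℕ) : ℝ) ^ (α - 1) ≤ ((2 ^ (j + 1) : ℕ) : ℝ) ^ (1 : ℝ) :=
            Real.rpow_le_rpow_of_exponent_le h1 (by linarith)
        _ = 2 ^ (j + 1) := by rw [Real.rpow_one]; push_cast; rfl
    have hlog : Real.log ((2 ^ (j + 1) : ℕ) : ℝ) ^ α
        = ((j + 1 : ℕ) : ℝ) ^ α * Real.log 2 ^ α := by
      rw [← Real.mul_rpow hj1.le hl.le, Nat.cast_pow, Real.log_pow]
      norm_cast
    have hden : 0 < ((j + 1 : ℕ) : ℝ) ^ α * Real.log 2 ^ α := by positivity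
    rw [hlog, Real.norm_of_nonneg hS0, Real.norm_of_nonneg (by positivity)] at hj
    rw [Real.norm_of_nonneg (hB0 j), Real.norm_of_nonneg (by positivity)]
    calc B j ≤ (∑ k ∈ Finset.range (2 ^ (j + 1) + 1), b k) / 2 ^ j := hblock
      _ ≤ (|C| * (2 ^ (j + 1) / (((j + 1 : ℕ) : ℝ) ^ α * Real.log 2 ^ α))) / 2 ^ j := by
          refine div_le_div_of_nonneg_right (hj.trans ?_) (by positivity)
          exact mul_le_mul (le_abs_self C) (div_le_div_of_nonneg_right hpow hden.le)
            (by positivity) (abs_nonneg C)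
      _ = |C| * 2 / Real.log 2 ^ α * (1 / ((j + 1 : ℕ) : ℝ) ^ α) := by
          have h2 : (0 : ℝ) < Real.log 2 ^ α := by positivity
          have h3 : (0 : ℝ) < ((j + 1 : ℕ) : ℝ) ^ α := by positivity
          rw [pow_succ]
          field_simp
  have hdyadic : ∀ N : ℕ, ∑ k ∈ Finset.range (2 ^ N), b k / k = ∑ j ∈ Finset.range N, B j := by
    intro N
    induction N with
    | zero => simp
    | succ N ih =>
      rw [Finset.sum_range_succ, ← ih, hB]
      exact (Finset.sum_range_add_sum_Ico _ (Nat.pow_le_pow_right two_pos N.le_succ)).symm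
  refine summable_of_sum_range_le (c := ∑' j, B j)
    (fun k => div_nonneg (hb k) (Nat.cast_nonneg k)) fun n => ?_
  calc ∑ k ∈ Finset.range n, b k / k ≤ ∑ k ∈ Finset.range (2 ^ n), b k / k :=
        Finset.sum_le_sum_of_subset_of_nonneg
          (Finset.range_mono Nat.lt_two_pow_self.le)
          fun k _ _ => div_nonneg (hb k) (Nat.cast_nonneg k)
    _ = ∑ j ∈ Finset.range n, B j := hdyadic n
    _ ≤ ∑' j, B j := hBsum.sum_le_tsum _ fun j _ => hB0 j

theorem summable_norm_div_of_mem_classM {α : ℝ} (hα₁ : 1 < α) (hα₂ : α ≤ 2) {a : ℤ → ℂ}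
    (ha : a ∈ classM α) : Summable fun i : ℤ => ‖a i / (i : ℂ)‖ := by
  -- Each half of `a` is dominated by the two-sided sums, through an injection `ℕ → ℤ`.
  have half : ∀ e : ℕ → ℤ, Function.Injective e → (∀ k, |e k| = k) →
      Summable fun k : ℕ => ‖a (e k)‖ / k := by
    intro e he habs
    refine summable_div_of_sum_range_isBigO hα₁ hα₂ (fun k => norm_nonneg _)
      (Asymptotics.IsBigO.trans (.of_norm_le fun n => ?_) ha)
    rw [Real.norm_of_nonneg (Finset.sum_nonneg fun k _ => norm_nonneg _),
      ← Finset.sum_image (f := fun i => ‖a i‖) he.injOn]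
    refine Finset.sum_le_sum_of_subset_of_nonneg (fun i hi => ?_) fun i _ _ => norm_nonneg _
    obtain ⟨k, hk, rfl⟩ := Finset.mem_image.1 hi
    rw [Finset.mem_Icc, ← abs_le, habs]
    have := Finset.mem_range.1 hk
    omega
  refine Summable.of_nat_of_neg ?_ ?_
  · simpa using half (fun k => (k : ℤ)) Nat.cast_injective (by simp)
  · simpa using half (fun k => -(k : ℤ)) (neg_injective.comp Nat.cast_injective) (by simp)

/-- An absolutely summable combination of functions bounded in `L¹` converges absolutely almost
everywhere, since its series of absolute values has finite integral. -/
theorem ae_summable_mul_of_eLpNorm_one_le {X ι : Type*} [Countable ι] [MeasurableSpace X]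
    {μ : Measure X} {f : ι → X → ℝ} (hf : ∀ i, AEStronglyMeasurable (f i) μ) {K : ENNReal}
    (hK : K ≠ ⊤) (hfK : ∀ i, eLpNorm (f i) 1 μ ≤ K) {c : ι → ℂ} (hc : Summable fun i => ‖c i‖) :
    ∀ᵐ x ∂μ, Summable fun i => c i * (f i x : ℂ) := by
  have hm : ∀ i, AEMeasurable (fun x => ‖c i‖ₑ * ‖f i x‖ₑ) μ := fun i =>
    (hf i).enorm.const_mul _
  have hcsum : ∑' i, ‖c i‖ₑ ≠ ⊤ := by
    simp only [← ofReal_norm]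
    exact hc.tsum_ofReal_ne_top
  have hint : ∫⁻ x, ∑' i, ‖c i‖ₑ * ‖f i x‖ₑ ∂μ ≠ ⊤ := by
    rw [lintegral_tsum hm]
    refine ne_top_of_le_ne_top (ENNReal.mul_ne_top hcsum hK) ?_
    rw [← ENNReal.tsum_mul_right]
    refine ENNReal.tsum_le_tsum fun i => ?_
    rw [lintegral_const_mul'' _ (hf i).enorm, ← eLpNorm_one_eq_lintegral_enorm]
    gcongr
    exact hfK i
  filter_upwards [ae_lt_top' (AEMeasurable.tsum hm) hint] with x hx
  refine Summable.of_enorm (ne_of_eq_of_ne (tsum_congr fun i => ?_) hx.ne)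
  rw [enorm_mul]
  congr 1
  simp [← ofReal_norm]

theorem theorem3p2 {X : Type*} [MeasurableSpace X] (μ : Measure X) [IsProbabilityMeasure μ]
    (T : X ≃ᵐ X) (hT : MeasurePreserving T μ μ)
    (α : ℝ) (hα₁ : 1 < α) (hα₂ : α ≤ 2)
    (f : ℤ → X → ℝ) (hf : IsAdmissibleProcess T μ 2 f)
    (hbdd : IsStronglyBounded μ 2 f) (hsymm : IsSymmetricProcess T μ f)
    (a : ℤ → ℂ) (ha : a ∈ classM α) :
    ∀ᵐ x ∂μ, ∃ l : ℂ, Tendsto (fun n : ℕ => modulatedHilbertSum a f n x) atTop (𝓝 l) := by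
  have hmeas : ∀ i, AEStronglyMeasurable (f i) μ := fun i => (hf.memLp i).aestronglyMeasurable
  have hL1 : ∀ i, eLpNorm (f i) 1 μ ≤ ⨆ n : ℤ, eLpNorm (f n) 2 μ := fun i =>
    (eLpNorm_le_eLpNorm_of_exponent_le one_le_two (hmeas i)).trans
      (le_iSup (fun n : ℤ => eLpNorm (f n) 2 μ) i)
  filter_upwards [ae_summable_mul_of_eLpNorm_one_le hmeas (ne_of_lt hbdd) hL1
    (summable_norm_div_of_mem_classM hα₁ hα₂ ha)] with x hx
  have hIcc : Tendsto (fun n : ℕ => Finset.Icc (-(n : ℤ)) (n : ℤ)) atTop atTop := by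
    refine tendsto_atTop_finset_of_monotone
      (fun m n hmn => Finset.Icc_subset_Icc (by omega) (by omega)) fun i => ⟨i.natAbs, ?_⟩
    rw [Finset.mem_Icc]
    omega
  refine ⟨_, (hx.hasSum.comp hIcc).congr fun n => ?_⟩
  -- The term `i = 0` vanishes since `a 0 / 0 = 0`, so erasing it does not change the sum.
  rw [modulatedHilbertSum, Finset.sum_erase _ (by simp)]
  exact Finset.sum_congr rfl fun i _ => by ring
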